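/- Let $M$ be a compact connected Riemannian manifold without boundary, of dimension $N\ge 1$, with geodesic distance $s_{xy}$. Fix $O\in M$, suppose that for each $x\in M$ there is an isometry $\tau_x:M\to M$ with $\tau_x(x)=O$, and let $\mu$ be a finite Borel measure on $M$ invariant under every $\tau_x$. Let $J:\mathbb R_{\ge 0}\to\mathbb R_{\ge 0}$ satisfy $\int_M J(s_{xO})\,d\mu(x)=1$, let $J(s)>0$ for $0\le s<s_0$ with some $s_0>0$, and let $x\mapsto J(s_{xO})$ be Lipschitz on $M$. Put $$L_0f(x)=\int_M J(s_{xy})f(y)\,d\mu(y),\qquad Lf=L_0f-f .$$ Assume that $L_0$ is positive semidefinite on $L^2(M,\mu)$, or that $-L$ has an eigenvalue in $(0,1)$ on $L^2(M,\mu)$. Then $-L$, as an operator in $L^2(M,\mu)$, has a smallest nonzero eigenvalue $\lambda_1$, and $\lambda_1>0$. Moreover there is a constant $C$, depending only on $M$, $\mu$ and $J$, such that for every $u_0\in L^\infty(M)$, if $u\in C([0,\infty);L^\infty(M))$ is the solution of $$u_t=Lu\quad (t>0),\qquad u(\cdot,0)=u_0$$ (with the time derivative taken in $L^\infty(M)$),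 then $$\|u(\cdot,t)-\langle u_0\rangle\|_{L^\infty(M)}\le C e^{-\lambda_1 t}\|u_0\|_{L^\infty(M)}\qquad\text{for all } t\ge 0,$$ where $\langle u_0\rangle=\frac1{\mu(M)}\int_M u_0\,d\mu$ is the mean value of $u_0$. -/

import Mathlib

open MeasureTheory Set Bundle
open scoped NNReal ENNReal Manifold

noncomputable section

namespace NonlocalDiffusion

variable {M : Type*} [MetricSpace M] [MeasurableSpace M]

/-- The averaging operator `L₀ f (x) = ∫ J(s_{xy}) f(y) dμ(y)`, with `s_{xy}` the distance. -/
def averageOp (J : ℝ≥0 → ℝ≥0) (μ : Measure M) (f : M → ℝ) (x : M) : ℝ :=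
  ∫ y, (J (nndist x y) : ℝ) * f y ∂μ

/-- The nonlocal operator `L f (x) = ∫ J(s_{xy}) f(y) dμ(y) - f(x)`. -/
def nonlocalOp (J : ℝ≥0 → ℝ≥0) (μ : Measure M) (f : M → ℝ) (x : M) : ℝ :=
  averageOp J μ f x - f x

/-- `lam` is an eigenvalue of `-L`, as an operator in `L²(M, μ)`. -/
def IsEigenvalueNeg (J : ℝ≥0 → ℝ≥0) (μ : Measure M) (lam : ℝ) : Prop :=
  ∃ φ : Lp ℝ 2 μ, φ ≠ 0 ∧ ∀ᵐ x ∂μ, -nonlocalOp J μ φ x = lam * φ x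

/-- `L₀` is a positive (semidefinite) operator in `L²(M, μ)`. -/
def IsPositiveAverage (J : ℝ≥0 → ℝ≥0) (μ : Measure M) : Prop :=
  ∀ f : Lp ℝ 2 μ, 0 ≤ ∫ x, averageOp J μ f x * f x ∂μ

/-- `u ∈ C([0, ∞); L^∞(M))` solves `u_t = L u` for `t > 0`, with `u(0) = u₀`; the time derivative
is taken in `L^∞(M)`. The values of `u` at negative times are irrelevant. -/
structure IsSolution (J : ℝ≥0 → ℝ≥0) (μ : Measure M) (u₀ : Lp ℝ ∞ μ) (u : ℝ → Lp ℝ ∞ μ) :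
    Prop where
  continuousOn : ContinuousOn u (Ici 0)
  initial : u 0 = u₀
  equation : ∀ t : ℝ, 0 < t →
    ∃ v : Lp ℝ ∞ μ, (∀ᵐ x ∂μ, v x = nonlocalOp J μ (u t) x) ∧ HasDerivAt u v t

end NonlocalDiffusion

end

/-! Transporting by the isometries makes `J (nndist x y)` a continuous symmetric kernel with unit
mass in each row, and gives `μ` full support. So `L₀` is compact and self-adjoint on `L²`, fixes
constants and preserves their orthogonal complement `V`. Eigenvectors of `-L` with nonzero
eigenvalue `λ` are eigenvectors of `L₀` in `V` with eigenvalue `1 - λ`; the smallest `λ` is `1 - m`,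
where `m` is the largest Rayleigh quotient on `V`. The spectral hypothesis ensures that `m ≥ 0` is
attained (`exists_top_eigenvalue`), and the strong maximum principle gives `m < 1`
(`eq_zero_of_kernelOp_eigen`).

For the decay (`norm_evolution_le`), an energy estimate gives the rate `1 - m` in `L²`. Since `L₀`
maps `L²` boundedly into `L^∞`, integrating `(e^t w)' = e^t L₀ w` transfers the same rate to `L^∞`.
-/

namespace NonlocalDiffusion

/-! ### Rayleigh quotients of compact symmetric operators -/

section Spectral

variable {H : Type*} [NormedAddCommGroup H] [InnerProductSpace ℝ H]

/-- Cauchy–Schwarz type bound for a symmetric operator that is positive on an invariant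
subspace. -/
theorem norm_sq_apply_le_of_nonneg (A : H →L[ℝ] H) (hA : ∀ x y, inner ℝ (A x) y = inner ℝ x (A y))
    (V : Submodule ℝ H) (hV : ∀ v ∈ V, A v ∈ V) (hpos : ∀ v ∈ V, 0 ≤ inner ℝ (A v) v)
    {w : H} (hw : w ∈ V) : ‖A w‖ ^ 2 ≤ (‖A‖ + 1) * inner ℝ (A w) w := by
  -- Positivity is tested on `w - c⁻¹ • A w`; the `+ 1` keeps `c` invertible when `A = 0`.
  set c := ‖A‖ + 1 with hc
  have hc0 : 0 < c := by positivity
  have h := hpos (w - c⁻¹ • A w) (V.sub_mem hw (V.smul_mem _ (hV w hw)))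
  simp only [map_sub, map_smul, inner_sub_left, inner_sub_right, inner_smul_left,
    inner_smul_right, RCLike.conj_to_real, hA (A w) w, real_inner_self_eq_norm_sq] at h
  have h2 : inner ℝ (A (A w)) (A w) ≤ c * ‖A w‖ ^ 2 := by
    calc inner ℝ (A (A w)) (A w) ≤ ‖A (A w)‖ * ‖A w‖ := real_inner_le_norm _ _
      _ ≤ (‖A‖ * ‖A w‖) * ‖A w‖ := by gcongr; exact A.le_opNorm _
      _ ≤ c * ‖A w‖ ^ 2 := by nlinarith [sq_nonneg ‖A w‖]
  have h3 : c⁻¹ * (c⁻¹ * inner ℝ (A (A w)) (A w)) ≤ c⁻¹ * (c⁻¹ * (c * ‖A w‖ ^ 2)) := by gcongr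
  have h4 : c⁻¹ * (c⁻¹ * (c * ‖A w‖ ^ 2)) = c⁻¹ * ‖A w‖ ^ 2 := by field_simp
  have h5 : c⁻¹ * ‖A w‖ ^ 2 ≤ inner ℝ (A w) w := by linarith
  calc ‖A w‖ ^ 2 = c * (c⁻¹ * ‖A w‖ ^ 2) := by field_simp
    _ ≤ c * inner ℝ (A w) w := by gcongr

/-- A compact symmetric operator whose quadratic form is somewhere positive on a closed invariant
subspace attains the supremum of its Rayleigh quotient there, at an eigenvector. -/
theorem exists_eigenvector_rayleigh_max (T : H →L[ℝ] H) (hT : IsCompactOperator T)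
    (hsym : ∀ x y, inner ℝ (T x) y = inner ℝ x (T y))
    (V : Submodule ℝ H) (hVc : IsClosed (V : Set H)) (hV : ∀ v ∈ V, T v ∈ V)
    (hpos : ∃ v ∈ V, 0 < inner ℝ (T v) v) :
    ∃ m : ℝ, 0 < m ∧ (∃ w ∈ V, w ≠ 0 ∧ T w = m • w) ∧
      ∀ v ∈ V, inner ℝ (T v) v ≤ m * ‖v‖ ^ 2 := by
  set s : Set ℝ := (fun v => inner ℝ (T v) v) '' {v | v ∈ V ∧ ‖v‖ = 1} with hs
  have hbdd : BddAbove s := by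
    refine ⟨‖T‖, ?_⟩
    rintro _ ⟨v, ⟨-, hv⟩, rfl⟩
    calc inner ℝ (T v) v ≤ ‖T v‖ * ‖v‖ := real_inner_le_norm _ _
      _ ≤ ‖T‖ * ‖v‖ * ‖v‖ := by gcongr; exact T.le_opNorm _
      _ = ‖T‖ := by simp [hv]
  have hscale : ∀ v : H, v ≠ 0 → inner ℝ (T (‖v‖⁻¹ • v)) (‖v‖⁻¹ • v) * ‖v‖ ^ 2 =
      inner ℝ (T v) v := by
    intro v hv
    have : ‖v‖ ≠ 0 := norm_ne_zero_iff.2 hv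
    simp only [map_smul, inner_smul_left, inner_smul_right, RCLike.conj_to_real]
    field_simp
  have hmem : ∀ v ∈ V, v ≠ 0 → inner ℝ (T (‖v‖⁻¹ • v)) (‖v‖⁻¹ • v) ∈ s := fun v hv h0 =>
    ⟨_, ⟨V.smul_mem _ hv, by simp [norm_smul, h0]⟩, rfl⟩
  obtain ⟨v₀, hv₀, hv₀pos⟩ := hpos
  have hv₀0 : v₀ ≠ 0 := by rintro rfl; simp at hv₀pos
  set m := sSup s with hm
  have hray : ∀ v ∈ V, inner ℝ (T v) v ≤ m * ‖v‖ ^ 2 := by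
    intro v hv
    by_cases h0 : v = 0
    · simp [h0]
    rw [← hscale v h0]
    gcongr
    exact le_csSup hbdd (hmem v hv h0)
  have hm0 : 0 < m := by
    have := hray v₀ hv₀
    by_contra hcon
    nlinarith [sq_nonneg ‖v₀‖]
  obtain ⟨a, -, ha, has⟩ := exists_seq_tendsto_sSup ⟨_, hmem v₀ hv₀ hv₀0⟩ hbdd
  choose w hw hwa using has
  -- `m - T` is nonnegative on `V`, so the previous lemma turns convergence of the Rayleigh
  -- quotients into `A (w n) → 0` in norm.
  set A : H →L[ℝ] H := m • ContinuousLinearMap.id ℝ H - T with hAdef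
  have hAapp : ∀ v, A v = m • v - T v := fun v => by simp [hAdef]
  have hAinner : ∀ v, inner ℝ (A v) v = m * ‖v‖ ^ 2 - inner ℝ (T v) v := fun v => by
    rw [hAapp, inner_sub_left, inner_smul_left, real_inner_self_eq_norm_sq]; simp
  have hAsym : ∀ x y, inner ℝ (A x) y = inner ℝ x (A y) := fun x y => by
    simp [hAapp, inner_sub_left, inner_sub_right, inner_smul_left, inner_smul_right, hsym]
  have hAto : Filter.Tendsto (fun n => A (w n)) Filter.atTop (nhds 0) := by
    have hb : ∀ n, ‖A (w n)‖ ^ 2 ≤ (‖A‖ + 1) * (m - a n) := fun n => by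
      have := norm_sq_apply_le_of_nonneg A hAsym V
        (fun v hv => by rw [hAapp]; exact V.sub_mem (V.smul_mem _ hv) (hV v hv))
        (fun v hv => by rw [hAinner]; linarith [hray v hv]) (hw n).1
      rw [hAinner, (hw n).2, one_pow, mul_one] at this
      simpa [hwa n] using this
    have hz : Filter.Tendsto (fun n => (‖A‖ + 1) * (m - a n)) Filter.atTop (nhds 0) := by
      have := (ha.const_sub m).const_mul (‖A‖ + 1)
      simpa [← hm] using this
    have h2 := squeeze_zero (fun n => sq_nonneg _) hb hz
    rw [tendsto_zero_iff_norm_tendsto_zero]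
    have h3 := h2.sqrt
    simpa [Real.sqrt_sq] using h3
  obtain ⟨K, hK, hKsub⟩ := IsCompactOperator.image_closedBall_subset_compact (𝕜₁ := ℝ)
    (f := (T : H →ₗ[ℝ] H)) hT 1
  obtain ⟨z, -, φ, hφ, hφz⟩ := hK.tendsto_subseq (x := fun n => T (w n))
    (fun n => hKsub ⟨w n, by simp [(hw n).2], rfl⟩)
  -- Compactness gives convergence of `T (w n)` only; `w n = m⁻¹ • (A (w n) + T (w n))` recovers
  -- that of `w n`, and needs `m > 0`.
  have hwlim : Filter.Tendsto (fun n => w (φ n)) Filter.atTop (nhds (m⁻¹ • z)) := by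
    have h1 := ((hAto.comp hφ.tendsto_atTop).add hφz).const_smul m⁻¹
    simp only [zero_add] at h1
    refine h1.congr fun n => ?_
    simp [hAapp, smul_smul, hm0.ne']
  set w' := m⁻¹ • z
  have hw'n : ‖w'‖ = 1 :=
    tendsto_nhds_unique hwlim.norm (by simp [(hw _).2])
  refine ⟨m, hm0, ⟨w', ?_, ?_, ?_⟩, hray⟩
  · exact hVc.mem_of_tendsto hwlim (Filter.Eventually.of_forall fun n => (hw _).1)
  · rintro h
    simp [h] at hw'n
  · have := tendsto_nhds_unique ((A.continuous.tendsto w').comp hwlim) (hAto.comp hφ.tendsto_atTop)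
    rw [hAapp, sub_eq_zero] at this
    exact this.symm

/-- The largest Rayleigh quotient on a nonzero closed invariant subspace, for a compact symmetric
operator that is positive there or has a positive eigenvalue there. -/
theorem exists_top_eigenvalue (T : H →L[ℝ] H) (hT : IsCompactOperator T)
    (hsym : ∀ x y, inner ℝ (T x) y = inner ℝ x (T y))
    (V : Submodule ℝ H) (hVc : IsClosed (V : Set H)) (hV : ∀ v ∈ V, T v ∈ V)
    (hne : ∃ v ∈ V, v ≠ 0)
    (h : (∀ v ∈ V, 0 ≤ inner ℝ (T v) v) ∨ ∃ v ∈ V, 0 < inner ℝ (T v) v) :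
    ∃ m : ℝ, 0 ≤ m ∧ (∃ w ∈ V, w ≠ 0 ∧ T w = m • w) ∧
      (∀ v ∈ V, inner ℝ (T v) v ≤ m * ‖v‖ ^ 2) ∧ (m = 0 → ∀ v ∈ V, T v = 0) := by
  by_cases hpos : ∃ v ∈ V, 0 < inner ℝ (T v) v
  · obtain ⟨m, hm, hw, hr⟩ := exists_eigenvector_rayleigh_max T hT hsym V hVc hV hpos
    exact ⟨m, hm.le, hw, hr, fun h0 => absurd h0 hm.ne'⟩
  · have hnn := h.resolve_right hpos
    push Not at hpos
    have hz : ∀ v ∈ V, T v = 0 := fun v hv => by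
      have h1 := norm_sq_apply_le_of_nonneg T hsym V hV hnn hv
      rw [le_antisymm (hpos v hv) (hnn v hv), mul_zero] at h1
      simpa using h1
    obtain ⟨v, hv, hv0⟩ := hne
    exact ⟨0, le_rfl, ⟨v, hv, hv0, by simp [hz v hv]⟩, fun v hv => by simpa using hpos v hv,
      fun _ => hz⟩

end Spectral

/-! ### Compactness via Arzelà–Ascoli -/

section KernelOperator

variable {X H : Type*} [TopologicalSpace X] [CompactSpace X]
  [NormedAddCommGroup H] [InnerProductSpace ℝ H]

/-- The operator `f ↦ (x ↦ ⟪K x, f⟫)` into continuous functions. -/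
noncomputable def innerOp (K : C(X, H)) : H →L[ℝ] C(X, ℝ) :=
  LinearMap.mkContinuous
    { toFun := fun f => ⟨fun x => inner ℝ (K x) f, by fun_prop⟩
      map_add' := fun f g => by ext x; simp [inner_add_right]
      map_smul' := fun c f => by ext x; simp [inner_smul_right] } ‖K‖ fun f => by
    rw [ContinuousMap.norm_le _ (by positivity)]
    intro x
    exact (norm_inner_le_norm _ _).trans (by gcongr; exact K.norm_coe_le_norm x)

/-- By Cauchy–Schwarz, images of the unit ball are bounded by `‖K‖` and inherit the modulus of
continuity of `K`, so Arzelà–Ascoli applies. -/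
theorem isCompactOperator_innerOp (K : C(X, H)) : IsCompactOperator (innerOp K) := by
  let e := (ContinuousMap.linearIsometryBoundedOfCompact X ℝ ℝ)
  have hc : IsCompactOperator (e.toContinuousLinearEquiv.toContinuousLinearMap.comp
      (innerOp K) : H →ₗ[ℝ] BoundedContinuousFunction X ℝ) := by
    rw [isCompactOperator_iff_isCompact_closure_image_closedBall (𝕜₁ := ℝ) _ one_pos]
    refine BoundedContinuousFunction.arzela_ascoli (Metric.closedBall 0 ‖K‖)
      (isCompact_closedBall _ _) _ ?_ ?_
    · rintro _ x ⟨f, hf, rfl⟩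
      have hf : ‖f‖ ≤ 1 := by simpa using hf
      have : ‖inner ℝ (K x) f‖ ≤ ‖K‖ * 1 :=
        (norm_inner_le_norm _ _).trans (by gcongr; exact K.norm_coe_le_norm x)
      rw [mem_closedBall_zero_iff, ← mul_one ‖K‖]
      exact this
    · intro x₀
      rw [Metric.equicontinuousAt_iff_right]
      intro ε hε
      filter_upwards [Metric.tendsto_nhds.1 (K.continuous.tendsto x₀) ε hε] with x hx
      rintro ⟨_, f, hf, rfl⟩
      have hf : ‖f‖ ≤ 1 := by simpa using hf
      change dist (inner ℝ (K x₀) f) (inner ℝ (K x) f) < ε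
      rw [dist_eq_norm, ← inner_sub_left]
      calc ‖inner ℝ (K x₀ - K x) f‖ ≤ ‖K x₀ - K x‖ * ‖f‖ := norm_inner_le_norm _ _
        _ ≤ ‖K x₀ - K x‖ * 1 := by gcongr
        _ < ε := by rw [mul_one, ← dist_eq_norm, dist_comm]; exact hx
  have h2 := hc.clm_comp e.symm.toContinuousLinearEquiv.toContinuousLinearMap
  convert! h2 using 1

end KernelOperator

/-! ### From `L²` decay to uniform decay -/

section Evolution

variable {E H : Type*} [NormedAddCommGroup E] [NormedSpace ℝ E]
  [NormedAddCommGroup H] [InnerProductSpace ℝ H]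

/-- The equation is available only for `t > 0`; the right derivative at `0` is recovered as a limit
of derivatives. -/
theorem eq_of_hasDerivAt_zero_Ici {f : ℝ → ℝ} (hc : ContinuousOn f (Ici 0))
    (hf : ∀ t, 0 < t → HasDerivAt f 0 t) {t : ℝ} (ht : 0 ≤ t) : f t = f 0 := by
  refine constant_of_has_deriv_right_zero (a := 0) (b := t) (hc.mono Icc_subset_Ici_self) ?_ t
    ⟨ht, le_rfl⟩
  intro x hx
  rcases hx.1.eq_or_lt with rfl | h
  · refine hasDerivWithinAt_Ici_of_tendsto_deriv (s := Ioi 0)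
      (fun y hy => (hf y hy).differentiableAt.differentiableWithinAt)
      ((hc 0 self_mem_Ici).mono Ioi_subset_Ici_self) self_mem_nhdsWithin ?_
    exact tendsto_const_nhds.congr' (by
      filter_upwards [self_mem_nhdsWithin] with y hy using (hf y hy).deriv.symm)
  · exact (hf x h).hasDerivWithinAt

/-- Exponential decay in `E` for `w' = R (ι w) - w`, when `ι ∘ R` is bounded by `m` in the sense of
quadratic forms on the orthogonal complement of `e` in `H`. -/
theorem norm_evolution_le (ι : E →L[ℝ] H) (R : H →L[ℝ] E) (e : H)
    (he : ∀ y, inner ℝ e (ι (R y)) = inner ℝ e y) {m B : ℝ} (hB : 0 ≤ B) (hm : 0 ≤ m)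
    (hray : ∀ y, inner ℝ e y = 0 → inner ℝ (ι (R y)) y ≤ m * ‖y‖ ^ 2)
    (hR : ∀ y, inner ℝ e y = 0 → ‖R y‖ ≤ B * m * ‖y‖)
    (w : ℝ → E) (hc : ContinuousOn w (Ici 0))
    (hw : ∀ t, 0 < t → HasDerivAt w (R (ι (w t)) - w t) t)
    (h0 : inner ℝ e (ι (w 0)) = 0) {t : ℝ} (ht : 0 ≤ t) :
    ‖w t‖ ≤ (1 + B * ‖ι‖) * Real.exp (-(1 - m) * t) * ‖w 0‖ := by
  have hyc : ContinuousOn (fun t => ι (w t)) (Ici 0) := ι.continuous.comp_continuousOn hc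
  have hy : ∀ t, 0 < t → HasDerivAt (fun t => ι (w t)) (ι (R (ι (w t))) - ι (w t)) t :=
    fun t ht => by
      simpa [Function.comp_def] using ι.hasFDerivAt.comp_hasDerivAt t (hw t ht)
  have horth : ∀ t, 0 ≤ t → inner ℝ e (ι (w t)) = 0 := fun t ht => by
    rw [← h0]
    refine eq_of_hasDerivAt_zero_Ici (f := fun t => inner ℝ e (ι (w t)))
      (continuousOn_const.inner hyc) (fun s hs => ?_) ht
    have := (hasDerivAt_const s e).inner ℝ (hy s hs)
    simpa [inner_sub_right, he] using this
  have hL2 : ∀ t, 0 ≤ t → ‖ι (w t)‖ ≤ Real.exp (-(1 - m) * t) * ‖ι (w 0)‖ := by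
    have hder : ∀ s, 0 < s → HasDerivAt
        (fun s => Real.exp (2 * (1 - m) * s) * ‖ι (w s)‖ ^ 2)
        (Real.exp (2 * (1 - m) * s) * (2 * (1 - m)) * ‖ι (w s)‖ ^ 2 +
          Real.exp (2 * (1 - m) * s) * (2 * inner ℝ (ι (w s)) (ι (R (ι (w s))) - ι (w s)))) s := by
      intro s hs
      have h1 : HasDerivAt (fun s : ℝ => Real.exp (2 * (1 - m) * s))
          (Real.exp (2 * (1 - m) * s) * (2 * (1 - m))) s := by
        simpa using ((hasDerivAt_id s).const_mul (2 * (1 - m))).exp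
      exact h1.mul (hy s hs).norm_sq
    have hanti : AntitoneOn (fun s => Real.exp (2 * (1 - m) * s) * ‖ι (w s)‖ ^ 2) (Ici 0) := by
      refine antitoneOn_of_deriv_nonpos (convex_Ici 0) ?_ ?_ ?_
      · exact ContinuousOn.mul (by fun_prop) (hyc.norm.pow 2)
      · intro s hs
        rw [interior_Ici] at hs
        exact (hder s hs).differentiableAt.differentiableWithinAt
      · intro s hs
        rw [interior_Ici] at hs
        rw [(hder s hs).deriv, inner_sub_right, real_inner_self_eq_norm_sq, real_inner_comm]
        have h1 := hray _ (horth s (le_of_lt hs))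
        have h2 := Real.exp_pos (2 * (1 - m) * s)
        nlinarith
    intro t ht
    have h1 := hanti self_mem_Ici ht ht
    simp only [mul_zero, Real.exp_zero, one_mul] at h1
    refine (pow_le_pow_iff_left₀ (norm_nonneg _) (by positivity) two_ne_zero).1 ?_
    have h2 : Real.exp (2 * (1 - m) * t) * (Real.exp (-(1 - m) * t)) ^ 2 = 1 := by
      rw [← Real.exp_nat_mul, ← Real.exp_add]
      simp
      ring
    have h3 := Real.exp_pos (2 * (1 - m) * t)
    rw [mul_pow]
    nlinarith [sq_nonneg (Real.exp (-(1 - m) * t)),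
      mul_le_mul_of_nonneg_left h1 (sq_nonneg (Real.exp (-(1 - m) * t)))]
  set D := ‖ι (w 0)‖ with hD
  have hzc : ContinuousOn (fun s => Real.exp s • w s) (Ici 0) :=
    Real.continuous_exp.continuousOn.smul hc
  have hzd : ∀ s, 0 < s → HasDerivAt (fun s => Real.exp s • w s)
      (Real.exp s • R (ι (w s))) s := fun s hs => by
    have := (Real.hasDerivAt_exp s).smul (hw s hs)
    convert! this using 1
    rw [smul_sub]; abel
  have hzr : ∀ s ∈ Ico 0 t, HasDerivWithinAt (fun s => Real.exp s • w s)
      (Real.exp s • R (ι (w s))) (Ici s) s := by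
    intro s hs
    rcases hs.1.eq_or_lt with rfl | h
    · refine hasDerivWithinAt_Ici_of_tendsto_deriv (s := Ioi 0)
        (fun y hy => (hzd y hy).differentiableAt.differentiableWithinAt)
        ((hzc 0 self_mem_Ici).mono Ioi_subset_Ici_self) self_mem_nhdsWithin ?_
      have h1 : ContinuousOn (fun s => Real.exp s • R (ι (w s))) (Ici 0) :=
        Real.continuous_exp.continuousOn.smul (R.continuous.comp_continuousOn hyc)
      refine (((h1 0 self_mem_Ici).mono Ioi_subset_Ici_self).tendsto).congr' ?_
      filter_upwards [self_mem_nhdsWithin] with y hy using (hzd y hy).deriv.symm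
    · exact (hzd s h).hasDerivWithinAt
  -- The factor `m` in `hR` makes the bound on the derivative integrate to `B * D * (exp (m * s) -
  -- 1)` without dividing by `m`, so `m = 0` is covered.
  have hbd := image_norm_le_of_norm_deriv_right_le_deriv_boundary
    (f := fun s => Real.exp s • w s) (f' := fun s => Real.exp s • R (ι (w s))) (a := 0) (b := t)
    (B := fun s => ‖w 0‖ + B * D * (Real.exp (m * s) - 1))
    (B' := fun s => B * D * (Real.exp (m * s) * m)) (hzc.mono Icc_subset_Ici_self) hzr
    (by simp) (fun s => by
      have h1 : HasDerivAt (fun s : ℝ => Real.exp (m * s)) (Real.exp (m * s) * m) s := by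
        simpa using ((hasDerivAt_id s).const_mul m).exp
      exact ((h1.sub_const 1).const_mul (B * D)).const_add _)
    (fun s hs => by
      rw [norm_smul, Real.norm_eq_abs, Real.abs_exp]
      calc Real.exp s * ‖R (ι (w s))‖ ≤ Real.exp s * (B * m * (Real.exp (-(1 - m) * s) * D)) := by
            gcongr
            exact (hR _ (horth s hs.1)).trans (by gcongr; exact hL2 s hs.1)
        _ = B * D * ((Real.exp s * Real.exp (-(1 - m) * s)) * m) := by ring
        _ = B * D * (Real.exp (m * s) * m) := by rw [← Real.exp_add]; ring_nf)
    (x := t) ⟨ht, le_rfl⟩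
  rw [norm_smul, Real.norm_eq_abs, Real.abs_exp] at hbd
  have hD1 : D ≤ ‖ι‖ * ‖w 0‖ := ι.le_opNorm _
  have h1 : 1 ≤ Real.exp (m * t) := Real.one_le_exp (by positivity)
  have h2 : Real.exp t * ‖w t‖ ≤ (1 + B * ‖ι‖) * Real.exp (m * t) * ‖w 0‖ := by
    have h3 : B * D ≤ B * (‖ι‖ * ‖w 0‖) := by gcongr
    have h4 : 0 ≤ B * D := by positivity
    nlinarith [mul_le_mul_of_nonneg_right h3 (Real.exp_pos (m * t)).le,
      mul_le_mul_of_nonneg_right h1 (norm_nonneg (w 0))]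
  have h3 : ‖w t‖ = Real.exp (-t) * (Real.exp t * ‖w t‖) := by
    rw [← mul_assoc, ← Real.exp_add]; simp
  rw [h3]
  calc Real.exp (-t) * (Real.exp t * ‖w t‖)
      ≤ Real.exp (-t) * ((1 + B * ‖ι‖) * Real.exp (m * t) * ‖w 0‖) := by gcongr
    _ = (1 + B * ‖ι‖) * (Real.exp (-t) * Real.exp (m * t)) * ‖w 0‖ := by ring
    _ = _ := by rw [← Real.exp_add]; ring_nf

end Evolution

/-! ### The inclusion of `L^∞` into `L²` -/

section Inclusion

variable {α : Type*} [MeasurableSpace α] (μ : Measure α) [IsFiniteMeasure μ]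

/-- The inclusion of `L^∞` into `L²` on a finite measure space. -/
noncomputable def linftyToL2 : Lp ℝ ∞ μ →L[ℝ] Lp ℝ 2 μ :=
  LinearMap.mkContinuous
    { toFun := fun f => ((Lp.memLp f).mono_exponent le_top).toLp f
      map_add' := fun f g => by
        rw [← MemLp.toLp_add, MemLp.toLp_eq_toLp_iff]
        exact Lp.coeFn_add f g
      map_smul' := fun c f => by
        rw [RingHom.id_apply, ← MemLp.toLp_const_smul, MemLp.toLp_eq_toLp_iff]
        exact Lp.coeFn_smul c f }
    (measureUnivNNReal μ ^ (2 : ℝ≥0∞).toReal⁻¹) fun f => by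
      refine Lp.norm_le_of_ae_bound (norm_nonneg f) ?_
      filter_upwards [MemLp.coeFn_toLp ((Lp.memLp f).mono_exponent (p := 2) le_top),
        ae_le_eLpNormEssSup (f := f) (μ := μ)] with x hx hx2
      change ‖((Lp.memLp f).mono_exponent (p := 2) le_top).toLp f x‖ ≤ ‖f‖
      rw [hx, Lp.norm_def, eLpNorm_exponent_top, ← toReal_enorm]
      exact ENNReal.toReal_mono (Lp.eLpNorm_lt_top f).ne hx2

theorem coeFn_linftyToL2 (f : Lp ℝ ∞ μ) : linftyToL2 μ f =ᵐ[μ] f :=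
  MemLp.coeFn_toLp ((Lp.memLp f).mono_exponent le_top)

theorem linftyToL2_injective : Function.Injective (linftyToL2 μ) := fun f g h => by
  have h1 := coeFn_linftyToL2 μ f
  rw [h] at h1
  exact Lp.ext (h1.symm.trans (coeFn_linftyToL2 μ g))

end Inclusion

/-! ### Integral operators with continuous kernel -/

section ContinuousKernel

variable {M : Type*} [TopologicalSpace M] [CompactSpace M] [MeasurableSpace M] [BorelSpace M]
  (μ : Measure M) [IsFiniteMeasure μ] (k : C(M, C(M, ℝ)))

/-- The integral operator with continuous kernel `k`, from `L²` to continuous functions. -/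
noncomputable def kernelOp : Lp ℝ 2 μ →L[ℝ] C(M, ℝ) :=
  innerOp (ContinuousMap.comp
    ⟨ContinuousMap.toLp 2 μ ℝ, (ContinuousMap.toLp 2 μ ℝ).continuous⟩ k)

theorem inner_toLp_left (g : C(M, ℝ)) (f : Lp ℝ 2 μ) :
    inner ℝ (ContinuousMap.toLp 2 μ ℝ g) f = ∫ x, g x * f x ∂μ := by
  rw [L2.inner_def]
  refine integral_congr_ae ?_
  filter_upwards [ContinuousMap.coeFn_toLp (p := 2) (𝕜 := ℝ) μ g] with x hx
  rw [hx, real_inner_eq_re_inner ℝ]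
  simp [mul_comm]

theorem kernelOp_apply (f : Lp ℝ 2 μ) (x : M) : kernelOp μ k f x = ∫ y, k x y * f y ∂μ :=
  inner_toLp_left μ (k x) f

theorem isCompactOperator_kernelOp : IsCompactOperator (kernelOp μ k) :=
  isCompactOperator_innerOp _

/-- The integral operator with continuous kernel `k` on `L²`. -/
noncomputable def kernelOpL2 : Lp ℝ 2 μ →L[ℝ] Lp ℝ 2 μ :=
  (ContinuousMap.toLp 2 μ ℝ).comp (kernelOp μ k)

theorem isCompactOperator_kernelOpL2 : IsCompactOperator (kernelOpL2 μ k) :=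
  (isCompactOperator_kernelOp μ k).clm_comp (ContinuousMap.toLp 2 μ ℝ)

theorem coeFn_kernelOpL2 (f : Lp ℝ 2 μ) : kernelOpL2 μ k f =ᵐ[μ] kernelOp μ k f :=
  ContinuousMap.coeFn_toLp (p := 2) (𝕜 := ℝ) μ _

variable {μ k}

theorem kernelOpL2_symm [SecondCountableTopology M] (hk : ∀ x y, k x y = k y x)
    (f g : Lp ℝ 2 μ) :
    inner ℝ (kernelOpL2 μ k f) g = inner ℝ f (kernelOpL2 μ k g) := by
  have hi : ∀ f : Lp ℝ 2 μ, Integrable f μ := fun f => (Lp.memLp f).integrable (by norm_num)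
  rw [real_inner_comm (kernelOpL2 μ k g) f]
  unfold kernelOpL2
  rw [ContinuousLinearMap.comp_apply, ContinuousLinearMap.comp_apply, inner_toLp_left,
    inner_toLp_left]
  simp only [kernelOp_apply, ← integral_mul_const]
  rw [integral_integral_swap]
  · refine integral_congr_ae (.of_forall fun x => integral_congr_ae (.of_forall fun y => ?_))
    simp only [hk y x]
    ring
  · have h1 : Integrable (fun z : M × M => f z.2 * g z.1) (μ.prod μ) := by
      simpa only [mul_comm] using (hi g).mul_prod (hi f)
    have h2 : Continuous fun z : M × M => k z.1 z.2 := by fun_prop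
    obtain ⟨C, hC⟩ := (isCompact_range h2).isBounded.exists_norm_le
    refine (h1.bdd_mul (c := C) h2.aestronglyMeasurable
      (.of_forall fun z => hC _ (mem_range_self z))).congr (.of_forall fun z => ?_)
    simp only [Function.uncurry]
    ring

theorem kernelOp_toLp (f : C(M, ℝ)) (x : M) :
    kernelOp μ k (ContinuousMap.toLp 2 μ ℝ f) x = ∫ y, k x y * f y ∂μ := by
  rw [kernelOp_apply]
  refine integral_congr_ae ?_
  filter_upwards [ContinuousMap.coeFn_toLp (p := 2) (𝕜 := ℝ) μ f] with y hy
  rw [hy]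

theorem kernelOp_one (hmass : ∀ x, ∫ y, k x y ∂μ = 1) :
    kernelOp μ k (ContinuousMap.toLp 2 μ ℝ 1) = 1 := by
  ext x
  rw [kernelOp_toLp]
  simpa using hmass x

theorem integrable_continuousMap (f : C(M, ℝ)) : Integrable f μ :=
  f.continuous.integrable_of_hasCompactSupport (HasCompactSupport.of_compactSpace f)

/-- Strong maximum principle: a mean zero eigenfunction with eigenvalue at least one vanishes. -/
theorem eq_zero_of_kernelOp_eigen [PreconnectedSpace M] [Nonempty M] [μ.IsOpenPosMeasure]
    (hnn : ∀ x y, 0 ≤ k x y) (hmass : ∀ x, ∫ y, k x y ∂μ = 1)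
    (hpos : ∀ x, ∀ᶠ y in nhds x, 0 < k x y) {f : C(M, ℝ)} {m : ℝ} (hm : 1 ≤ m)
    (hf : ∀ x, ∫ y, k x y * f y ∂μ = m * f x) (hmean : ∫ x, f x ∂μ = 0) : f = 0 := by
  have hvol : 0 < μ.real univ := by
    rw [measureReal_def, ENNReal.toReal_pos_iff]
    exact ⟨isOpen_univ.measure_pos μ univ_nonempty, measure_lt_top _ _⟩
  obtain ⟨x₀, -, hx₀⟩ := isCompact_univ.exists_isMaxOn univ_nonempty f.continuous.continuousOn
  have hmax : ∀ y, f y ≤ f x₀ := fun y => hx₀ (mem_univ y)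
  have hx₀0 : 0 ≤ f x₀ := by
    have h1 : ∫ x, f x ∂μ ≤ ∫ _, f x₀ ∂μ :=
      integral_mono (integrable_continuousMap f) (integrable_const _) hmax
    rw [hmean, integral_const, smul_eq_mul] at h1
    exact nonneg_of_mul_nonneg_right h1 hvol
  -- At a maximum point `x`, `∫ k x y * (f x₀ - f y) = (1 - m) * f x₀ ≤ 0`. The integrand is
  -- nonnegative and continuous, so full support makes it vanish; hence `f = f x₀` where `k x` is
  -- positive, in particular near `x`.
  have hclopen : IsClopen {x | f x = f x₀} := by
    refine ⟨isClosed_eq f.continuous continuous_const, isOpen_iff_mem_nhds.2 fun x hx => ?_⟩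
    have hx : f x = f x₀ := hx
    have hcont : Continuous fun y => k x y * (f x₀ - f y) := by fun_prop
    have hnn' : ∀ y, 0 ≤ k x y * (f x₀ - f y) := fun y =>
      mul_nonneg (hnn x y) (sub_nonneg.2 (hmax y))
    have hi1 : Integrable (fun y => k x y * f y) μ := integrable_continuousMap (k x * f)
    have hi2 : Integrable (fun y => k x y * f x₀) μ :=
      (integrable_continuousMap (k x)).mul_const _
    have hint : ∫ y, k x y * (f x₀ - f y) ∂μ = 0 := by
      refine le_antisymm ?_ (integral_nonneg hnn')
      simp only [mul_sub]
      rw [integral_sub hi2 hi1, integral_mul_const, hmass, hf, hx]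
      nlinarith
    have hz : (fun y => k x y * (f x₀ - f y)) = 0 := by
      have h1 := (integral_eq_zero_iff_of_nonneg hnn' (by
        refine (hi2.sub hi1).congr (.of_forall fun y => ?_)
        simp only [Pi.sub_apply, mul_sub])).1 hint
      exact (hcont.ae_eq_iff_eq μ continuous_const).1 h1
    filter_upwards [hpos x] with y hy
    have := congrFun hz y
    simp only [Pi.zero_apply, mul_eq_zero, hy.ne', false_or] at this
    exact (sub_eq_zero.1 this).symm
  have huniv := hclopen.eq_univ ⟨x₀, rfl⟩
  have hconst : ∀ x, f x = f x₀ := fun x => by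
    have : x ∈ {x | f x = f x₀} := huniv ▸ mem_univ x
    exact this
  have h0 : f x₀ = 0 := by
    simp only [hconst, integral_const, smul_eq_mul] at hmean
    exact (mul_eq_zero.1 hmean).resolve_left hvol.ne'
  ext x
  rw [hconst x, h0]; rfl

end ContinuousKernel

/-! ### Full support of the invariant measure -/

section Support

variable {M : Type*} [MetricSpace M] [SecondCountableTopology M]
  [MeasurableSpace M] [BorelSpace M]

/-- A nonzero measure invariant under a family of isometries moving every point to a fixed one has
full support. -/
theorem isOpenPosMeasure_of_isometries {μ : Measure M} (hμ0 : μ ≠ 0) (O : M) (τ : M → M ≃ᵢ M)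
    (hτ : ∀ x : M, τ x x = O) (hμ : ∀ x : M, MeasurePreserving (τ x) μ μ) :
    μ.IsOpenPosMeasure := by
  have key : ∀ x, ∀ U ∈ nhds x, μ U ≠ 0 := by
    -- A nonzero measure has some point in its support; `τ p` carries this property to `O`, and `(τ
    -- x).symm` from `O` to any `x`.
    obtain ⟨p, hp⟩ : ∃ p, ∀ U ∈ nhds p, μ U ≠ 0 := by
      by_contra! h
      refine hμ0 (Measure.measure_univ_eq_zero.1 (measure_null_of_locally_null univ fun x _ => ?_))
      obtain ⟨U, hU, hU0⟩ := h x
      exact ⟨U, nhdsWithin_le_nhds hU, hU0⟩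
    have hO : ∀ U ∈ nhds O, μ U ≠ 0 := fun U hU h0 => by
      have h1 : (τ p) ⁻¹' U ∈ nhds p := (τ p).continuous.continuousAt (by rwa [hτ])
      exact hp _ h1 ((hμ p).quasiMeasurePreserving.preimage_null h0)
    intro x U hU h0
    have h1 : (τ x).symm ⁻¹' U ∈ nhds O := by
      refine (τ x).symm.continuous.continuousAt ?_
      rwa [← hτ x, IsometryEquiv.symm_apply_apply]
    refine hO _ h1 ?_
    have h2 := (hμ x).measure_preimage_equiv (f := (τ x).toHomeomorph.toMeasurableEquiv)
      ((τ x).symm ⁻¹' U)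
    rw [← h2, ← h0]
    congr 1
    ext y
    simp
  exact ⟨fun U hU ⟨x, hx⟩ => key x U (hU.mem_nhds hx)⟩

end Support

/-! ### Continuity of the radial kernel -/

section DistanceKernel

variable {M : Type*} [MetricSpace M] [CompactSpace M]

/-- Under transitive isometries, a radial Lipschitz profile defines a continuous kernel. -/
theorem exists_continuous_kernel (O : M) (τ : M → M ≃ᵢ M) (hτ : ∀ x : M, τ x x = O)
    (J : ℝ≥0 → ℝ≥0) (hJ_lip : ∃ K : ℝ≥0, LipschitzWith K (fun x : M => J (nndist x O))) :
    ∃ k : C(M, C(M, ℝ)), ∀ x y, k x y = J (nndist x y) := by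
  obtain ⟨K, hK⟩ := hJ_lip
  -- Moving `y` to `O` by `τ y` gives a Lipschitz constant independent of `y`, hence continuity into
  -- `C(M, ℝ)` with the sup norm.
  have h1 : ∀ x x' y, nndist (J (nndist x y)) (J (nndist x' y)) ≤ K * nndist x x' := fun x x' y => by
    have h := hK.nndist_le (τ y x) (τ y x')
    have h2 : ∀ z, nndist (τ y z) O = nndist z y := fun z => by
      conv_lhs => rw [← hτ y]
      exact (τ y).isometry.nndist_eq z y
    rwa [h2, h2, (τ y).isometry.nndist_eq] at h
  have h3 : ∀ x, Continuous fun y => (J (nndist x y) : ℝ) := fun x => by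
    have h4 : LipschitzWith K fun y : M => J (nndist x y) := by
      refine LipschitzWith.of_dist_le_mul fun y y' => ?_
      rw [nndist_comm x y, nndist_comm x y']
      exact_mod_cast h1 y y' x
    exact NNReal.continuous_coe.comp h4.continuous
  refine ⟨⟨fun x => ⟨fun y => J (nndist x y), h3 x⟩, ?_⟩, fun x y => rfl⟩
  refine (LipschitzWith.of_dist_le_mul (K := K) fun x x' => ?_).continuous
  rw [ContinuousMap.dist_le (by positivity)]
  intro y
  exact_mod_cast h1 x x' y

end DistanceKernel

/-! ### Spectral gap and decay for the nonlocal operator -/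

section Main

variable {M : Type*} [MetricSpace M] [CompactSpace M] [MeasurableSpace M] [BorelSpace M]
  {μ : Measure M} [IsFiniteMeasure μ] {J : ℝ≥0 → ℝ≥0} {k : C(M, C(M, ℝ))}

theorem averageOp_eq_kernelOp (hkJ : ∀ x y, k x y = J (nndist x y)) (f : Lp ℝ 2 μ) (x : M) :
    averageOp J μ f x = kernelOp μ k f x := by
  simp only [averageOp, kernelOp_apply, hkJ]

theorem isEigenvalueNeg_iff (hkJ : ∀ x y, k x y = J (nndist x y)) (lam : ℝ) :
    IsEigenvalueNeg J μ lam ↔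
      ∃ φ : Lp ℝ 2 μ, φ ≠ 0 ∧ kernelOpL2 μ k φ = (1 - lam) • φ := by
  refine exists_congr fun φ => and_congr_right fun _ => ?_
  constructor
  · intro h
    apply Lp.ext
    filter_upwards [h, coeFn_kernelOpL2 μ k φ, Lp.coeFn_smul (1 - lam) φ] with x h1 h2 h3
    rw [h2, h3, ← averageOp_eq_kernelOp hkJ, Pi.smul_apply, smul_eq_mul]
    simp only [nonlocalOp] at h1
    linarith
  · intro h
    have h4 := Lp.coeFn_smul (1 - lam) φ
    rw [← h] at h4
    filter_upwards [coeFn_kernelOpL2 μ k φ, h4] with x h2 h3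
    rw [h2, ← averageOp_eq_kernelOp hkJ, Pi.smul_apply, smul_eq_mul] at h3
    simp only [nonlocalOp]
    linarith

theorem isPositiveAverage_iff (hkJ : ∀ x y, k x y = J (nndist x y)) :
    IsPositiveAverage J μ ↔ ∀ f : Lp ℝ 2 μ, 0 ≤ inner ℝ (kernelOpL2 μ k f) f := by
  refine forall_congr' fun f => ?_
  rw [kernelOpL2, ContinuousLinearMap.comp_apply, inner_toLp_left]
  simp only [averageOp_eq_kernelOp hkJ]

/-- There is a nonzero mean zero function in `L²` of a space with more than one point. -/
theorem exists_ne_zero_mean_zero [Nontrivial M] [μ.IsOpenPosMeasure] :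
    ∃ v : Lp ℝ 2 μ, inner ℝ (ContinuousMap.toLp 2 μ ℝ 1) v = 0 ∧ v ≠ 0 := by
  obtain ⟨p, q, hpq⟩ := exists_pair_ne M
  let g : C(M, ℝ) := ⟨fun y => dist p y, by fun_prop⟩
  let c : ℝ := ⨍ x, g x ∂μ
  have hμ0 : NeZero μ := ⟨fun h =>
    isOpen_univ.measure_ne_zero μ ⟨p, mem_univ p⟩ (by simp [h])⟩
  refine ⟨ContinuousMap.toLp 2 μ ℝ (g - ContinuousMap.const M c), ?_, fun h => ?_⟩
  · have h1 := ContinuousMap.inner_toLp (𝕜 := ℝ) μ 1 (g - ContinuousMap.const M c)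
    rw [h1]
    simpa using integral_sub_average μ g
  · rw [← map_zero (ContinuousMap.toLp (E := ℝ) 2 μ ℝ), ContinuousMap.toLp_inj] at h
    have hp := DFunLike.congr_fun h p
    have hq := DFunLike.congr_fun h q
    simp only [ContinuousMap.sub_apply, ContinuousMap.const_apply, ContinuousMap.zero_apply] at hp hq
    have h2 : dist p q = dist p p := by
      change g q = g p
      linarith
    rw [dist_self, dist_eq_zero] at h2
    exact hpq h2

theorem spectral_gap_and_decay [Nontrivial M] [PreconnectedSpace M] [μ.IsOpenPosMeasure]
    (hkJ : ∀ x y, k x y = J (nndist x y)) (hmass : ∀ x, ∫ y, k x y ∂μ = 1)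
    (hJ_pos : ∃ s₀ : ℝ≥0, 0 < s₀ ∧ ∀ s : ℝ≥0, s < s₀ → 0 < J s)
    (hspec : IsPositiveAverage J μ ∨
      ∃ lam : ℝ, 0 < lam ∧ lam < 1 ∧ IsEigenvalueNeg J μ lam) :
    ∃ lam₁ : ℝ,
      IsLeast {lam : ℝ | lam ≠ 0 ∧ IsEigenvalueNeg J μ lam} lam₁ ∧
      0 < lam₁ ∧
      ∃ C : ℝ, ∀ (u₀ : Lp ℝ ∞ μ) (u : ℝ → Lp ℝ ∞ μ),
        IsSolution J μ u₀ u →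
        ∀ t : ℝ, 0 ≤ t →
          ‖u t - Lp.const ∞ μ (⨍ x, u₀ x ∂μ)‖ ≤ C * Real.exp (-lam₁ * t) * ‖u₀‖ := by
  have hksymm : ∀ x y, k x y = k y x := fun x y => by rw [hkJ, hkJ, nndist_comm]
  have hknn : ∀ x y, 0 ≤ k x y := fun x y => by rw [hkJ]; positivity
  have hkpos : ∀ x, ∀ᶠ y in nhds x, 0 < k x y := fun x => by
    obtain ⟨s₀, hs₀, hJ⟩ := hJ_pos
    filter_upwards [Metric.ball_mem_nhds x (NNReal.coe_pos.2 hs₀)] with y hy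
    rw [hkJ]
    refine NNReal.coe_pos.2 (hJ _ ?_)
    rw [← NNReal.coe_lt_coe, coe_nndist, dist_comm]
    exact hy
  obtain ⟨e, he⟩ : ∃ e : Lp ℝ 2 μ, e = ContinuousMap.toLp 2 μ ℝ 1 := ⟨_, rfl⟩
  have he_inner : ∀ f : Lp ℝ 2 μ, inner ℝ e f = ∫ x, f x ∂μ := fun f => by
    rw [he, inner_toLp_left]; simp
  set T := kernelOpL2 μ k with hT
  have hsym : ∀ f g, inner ℝ (T f) g = inner ℝ f (T g) := kernelOpL2_symm hksymm
  have hSe : kernelOp μ k e = 1 := by rw [he, kernelOp_one hmass]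
  have hTe : T e = e := by
    rw [hT, kernelOpL2, ContinuousLinearMap.comp_apply, hSe, he]
  have heT : ∀ f, inner ℝ e (T f) = inner ℝ e f := fun f => by rw [← hsym, hTe]
  set V : Submodule ℝ (Lp ℝ 2 μ) := (ℝ ∙ e)ᗮ with hVdef
  have hVmem : ∀ v, v ∈ V ↔ inner ℝ e v = 0 := fun v =>
    Submodule.mem_orthogonal_singleton_iff_inner_right
  have heig_mem : ∀ ν : ℝ, ν ≠ 1 → ∀ φ, T φ = ν • φ → φ ∈ V := fun ν hν φ hφ => by
    have h := heT φ
    rw [hφ, inner_smul_right] at h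
    rw [hVmem]
    have h2 : (ν - 1) * inner ℝ e φ = 0 := by linarith
    exact (mul_eq_zero.1 h2).resolve_left (sub_ne_zero.2 hν)
  have heig_inner : ∀ ν : ℝ, ∀ φ, T φ = ν • φ → inner ℝ (T φ) φ = ν * ‖φ‖ ^ 2 := fun ν φ hφ => by
    rw [hφ, inner_smul_left, real_inner_self_eq_norm_sq]; simp
  obtain ⟨m, hm0, ⟨w, hwV, hw0, hTw⟩, hray, hmz⟩ := exists_top_eigenvalue T
    (isCompactOperator_kernelOpL2 μ k) hsym V (Submodule.isClosed_orthogonal _)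
    (fun v hv => by rw [hVmem, heT]; exact (hVmem v).1 hv)
    (by
      obtain ⟨v, hv, hv0⟩ := exists_ne_zero_mean_zero (μ := μ)
      exact ⟨v, (hVmem v).2 (he ▸ hv), hv0⟩)
    (by
      refine hspec.imp (fun h v _ => (isPositiveAverage_iff hkJ).1 h v) ?_
      rintro ⟨lam, hl0, hl1, hl⟩
      obtain ⟨φ, hφ0, hφ⟩ := (isEigenvalueNeg_iff hkJ lam).1 hl
      refine ⟨φ, heig_mem _ (by linarith) φ hφ, ?_⟩
      rw [heig_inner _ φ hφ]
      have : 0 < ‖φ‖ := norm_pos_iff.2 hφ0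
      have : 0 < 1 - lam := by linarith
      positivity)
  have hm1 : m < 1 := by
    by_contra! hcon
    have hm_ne : m ≠ 0 := by linarith
    -- The eigenvector has a continuous representative, to which the maximum principle applies.
    have hwf : ContinuousMap.toLp 2 μ ℝ (m⁻¹ • kernelOp μ k w) = w := by
      rw [map_smul]
      change m⁻¹ • T w = w
      rw [hTw, smul_smul, inv_mul_cancel₀ hm_ne, one_smul]
    have hf0 := eq_zero_of_kernelOp_eigen (μ := μ) (f := m⁻¹ • kernelOp μ k w) hknn hmass hkpos hcon
      (fun x => by
        rw [← kernelOp_toLp, hwf, ContinuousMap.smul_apply, smul_eq_mul, mul_inv_cancel_left₀ hm_ne])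
      (by
        have h1 := (hVmem w).1 hwV
        rw [← hwf, he_inner] at h1
        rw [← h1]
        exact integral_congr_ae (ContinuousMap.coeFn_toLp (p := 2) (𝕜 := ℝ) μ _).symm)
    rw [hf0, map_zero] at hwf
    exact hw0 hwf.symm
  refine ⟨1 - m, ⟨⟨by linarith, ?_⟩, ?_⟩, by linarith, ?_⟩
  · rw [isEigenvalueNeg_iff hkJ]
    exact ⟨w, hw0, by rw [sub_sub_cancel]; exact hTw⟩
  · rintro lam ⟨hl0, hl⟩
    obtain ⟨φ, hφ0, hφ⟩ := (isEigenvalueNeg_iff hkJ lam).1 hl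
    have h1 := hray φ (heig_mem _ (by simpa using hl0) φ hφ)
    rw [heig_inner _ φ hφ] at h1
    have : 0 < ‖φ‖ ^ 2 := by have := norm_pos_iff.2 hφ0; positivity
    have := le_of_mul_le_mul_right h1 this
    linarith
  set ι := linftyToL2 μ with hι
  set R : Lp ℝ 2 μ →L[ℝ] Lp ℝ ∞ μ := (ContinuousMap.toLp ∞ μ ℝ).comp (kernelOp μ k) with hR
  have hιC : ∀ f : C(M, ℝ), ι (ContinuousMap.toLp ∞ μ ℝ f) = ContinuousMap.toLp 2 μ ℝ f := by
    intro f
    apply Lp.ext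
    exact (coeFn_linftyToL2 μ _).trans ((ContinuousMap.coeFn_toLp (p := ∞) (𝕜 := ℝ) μ f).trans
      (ContinuousMap.coeFn_toLp (p := 2) (𝕜 := ℝ) μ f).symm)
  have hιR : ∀ y, ι (R y) = T y := fun y => hιC _
  -- If `m = 0`, then `T`, and by injectivity of `ι` also `R`, vanishes on `V`, so `B = 0` works.
  have hRbound : ∃ B : ℝ, 0 ≤ B ∧ ∀ y, inner ℝ e y = 0 → ‖R y‖ ≤ B * m * ‖y‖ := by
    rcases hm0.eq_or_lt with h | h
    · refine ⟨0, le_rfl, fun y hy => ?_⟩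
      have h1 : R y = 0 := linftyToL2_injective μ (by
        rw [← hι, hιR, hmz h.symm y ((hVmem y).2 hy), map_zero])
      simp [h1]
    · refine ⟨‖R‖ / m, by positivity, fun y _ => ?_⟩
      rw [div_mul_cancel₀ _ h.ne']
      exact R.le_opNorm y
  obtain ⟨B, hB, hRB⟩ := hRbound
  have hconst : ∀ c : ℝ, Lp.const ∞ μ c = ContinuousMap.toLp ∞ μ ℝ (ContinuousMap.const M c) := by
    intro c
    apply Lp.ext
    exact (Lp.coeFn_const ∞ μ c).trans
      (ContinuousMap.coeFn_toLp (p := ∞) (𝕜 := ℝ) μ (ContinuousMap.const M c)).symm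
  have hιconst : ∀ c : ℝ, ι (Lp.const ∞ μ c) = c • e := fun c => by
    rw [hconst, hιC, he, ← map_smul]
    congr 1
    ext x; simp
  have hRconst : ∀ c : ℝ, R (ι (Lp.const ∞ μ c)) = Lp.const ∞ μ c := fun c => by
    rw [hιconst, map_smul, hR, ContinuousLinearMap.comp_apply, hSe, hconst, ← map_smul]
    congr 1
    ext x; simp
  have hvol : 0 < μ.real univ := by
    rw [measureReal_def, ENNReal.toReal_pos_iff]
    exact ⟨isOpen_univ.measure_pos μ univ_nonempty, measure_lt_top _ _⟩
  have hmean : ∀ f : Lp ℝ ∞ μ, inner ℝ e (ι f) = ∫ x, f x ∂μ := fun f => by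
    rw [he_inner]
    exact integral_congr_ae (coeFn_linftyToL2 μ f)
  have hnormconst : ∀ f : Lp ℝ ∞ μ, ‖f - Lp.const ∞ μ (⨍ x, f x ∂μ)‖ ≤
      (1 + (μ.real univ)⁻¹ * (‖e‖ * ‖ι‖)) * ‖f‖ := fun f => by
    have h1 : ‖Lp.const ∞ μ (⨍ x, f x ∂μ)‖ ≤ ‖⨍ x, f x ∂μ‖ := by
      simpa using Lp.norm_const_le ∞ μ (⨍ x, f x ∂μ)
    have h2 : ‖⨍ x, f x ∂μ‖ ≤ (μ.real univ)⁻¹ * (‖e‖ * (‖ι‖ * ‖f‖)) := by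
      rw [average_eq, ← hmean, norm_smul, Real.norm_of_nonneg (by positivity)]
      gcongr
      exact (norm_inner_le_norm _ _).trans (by gcongr; exact ι.le_opNorm f)
    calc _ ≤ ‖f‖ + ‖Lp.const ∞ μ (⨍ x, f x ∂μ)‖ := norm_sub_le _ _
      _ ≤ ‖f‖ + (μ.real univ)⁻¹ * (‖e‖ * (‖ι‖ * ‖f‖)) := by linarith
      _ = _ := by ring
  refine ⟨(1 + B * ‖ι‖) * (1 + (μ.real univ)⁻¹ * (‖e‖ * ‖ι‖)), fun u₀ u hu t ht => ?_⟩
  set c := ⨍ x, u₀ x ∂μ with hc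
  have hdec := norm_evolution_le ι R e (fun y => by rw [hιR, heT]) hB hm0
    (fun y hy => by rw [hιR]; exact hray y ((hVmem y).2 hy)) hRB
    (fun t => u t - Lp.const ∞ μ c) (hu.continuousOn.sub continuousOn_const)
    (fun s hs => by
      obtain ⟨v, hv, hd⟩ := hu.equation s hs
      have hv2 : v = R (ι (u s)) - u s := by
        apply Lp.ext
        filter_upwards [hv, Lp.coeFn_sub (R (ι (u s))) (u s),
          ContinuousMap.coeFn_toLp (p := ∞) (𝕜 := ℝ) μ (kernelOp μ k (ι (u s)))] with x h1 h2 h3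
        rw [h1, h2, Pi.sub_apply]
        have h4 : (R (ι (u s)) : M → ℝ) x = kernelOp μ k (ι (u s)) x := h3
        rw [h4, ← averageOp_eq_kernelOp hkJ, nonlocalOp]
        congr 1
        refine integral_congr_ae ?_
        filter_upwards [coeFn_linftyToL2 μ (u s)] with y hy
        rw [hι, hy]
      have hd' := hd.sub_const (Lp.const ∞ μ c)
      convert! hd' using 1
      rw [hv2, map_sub, map_sub, hRconst]
      abel)
    (by
      have hee : inner ℝ e e = μ.real univ := by
        have h1 := ContinuousMap.inner_toLp (𝕜 := ℝ) μ 1 1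
        rw [← he] at h1
        simpa using h1
      rw [hu.initial, map_sub, inner_sub_right, hmean, hιconst, inner_smul_right, hee, hc,
        average_eq, smul_eq_mul, mul_comm, mul_inv_cancel_left₀ hvol.ne', sub_self]) ht
  refine hdec.trans ?_
  simp only [hu.initial]
  calc _ ≤ (1 + B * ‖ι‖) * Real.exp (-(1 - m) * t) *
        ((1 + (μ.real univ)⁻¹ * (‖e‖ * ‖ι‖)) * ‖u₀‖) := by
        gcongr
        exact hnormconst u₀
    _ = _ := by ring

end Main

end NonlocalDiffusion

theorem mainTheorem8 {N : ℕ} (hN : 0 < N) {M : Type*} [MetricSpace M]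
    [ChartedSpace (EuclideanSpace ℝ (Fin N)) M] [IsManifold (𝓡 N) 1 M]
    [RiemannianBundle (fun x : M => TangentSpace (𝓡 N) x)]
    [IsContinuousRiemannianBundle (EuclideanSpace ℝ (Fin N)) (fun x : M => TangentSpace (𝓡 N) x)]
    [IsRiemannianManifold (𝓡 N) M] [CompactSpace M] [ConnectedSpace M]
    [MeasurableSpace M] [BorelSpace M] (μ : Measure M) [IsFiniteMeasure μ]
    (O : M) (τ : M → M ≃ᵢ M) (hτ : ∀ x : M, τ x x = O)
    (hμ : ∀ x : M, MeasurePreserving (τ x) μ μ)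
    (J : ℝ≥0 → ℝ≥0) (hJ_mass : ∫ x, (J (nndist x O) : ℝ) ∂μ = 1)
    (hJ_pos : ∃ s₀ : ℝ≥0, 0 < s₀ ∧ ∀ s : ℝ≥0, s < s₀ → 0 < J s)
    (hJ_lip : ∃ K : ℝ≥0, LipschitzWith K (fun x : M => J (nndist x O)))
    (hspec : NonlocalDiffusion.IsPositiveAverage J μ ∨
      ∃ lam : ℝ, 0 < lam ∧ lam < 1 ∧ NonlocalDiffusion.IsEigenvalueNeg J μ lam) :
    ∃ lam₁ : ℝ,
      IsLeast {lam : ℝ | lam ≠ 0 ∧ NonlocalDiffusion.IsEigenvalueNeg J μ lam} lam₁ ∧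
      0 < lam₁ ∧
      ∃ C : ℝ, ∀ (u₀ : Lp ℝ ∞ μ) (u : ℝ → Lp ℝ ∞ μ),
        NonlocalDiffusion.IsSolution J μ u₀ u →
        ∀ t : ℝ, 0 ≤ t →
          ‖u t - Lp.const ∞ μ (⨍ x, u₀ x ∂μ)‖ ≤ C * Real.exp (-lam₁ * t) * ‖u₀‖ := by
  -- In dimension `N ≥ 1` a one-point `M` would make a singleton a neighbourhood in Euclidean space.
  -- Two points are needed for `V` to be nonzero.
  have : Nontrivial M := by
    by_contra hM
    rw [not_nontrivial_iff_subsingleton] at hM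
    have : Nonempty (Fin N) := ⟨⟨0, hN⟩⟩
    let φ := chartAt (EuclideanSpace ℝ (Fin N)) O
    have h1 : φ.target ∈ nhds (φ O) := φ.open_target.mem_nhds
      (φ.map_source (mem_chart_source _ O))
    have h2 : φ.target ⊆ {φ O} := fun y hy => by
      rw [mem_singleton_iff, ← φ.right_inv hy, Subsingleton.elim (φ.symm y) O]
    have h3 := Filter.mem_of_superset h1 h2
    have h4 : (nhdsWithin (φ O) {φ O}ᶜ).NeBot := inferInstance
    have h5 := h4.nonempty_of_mem (Filter.inter_mem (nhdsWithin_le_nhds h3) self_mem_nhdsWithin)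
    simp at h5
  have hμ0 : μ ≠ 0 := by
    rintro rfl
    simp at hJ_mass
  have := NonlocalDiffusion.isOpenPosMeasure_of_isometries hμ0 O τ hτ hμ
  obtain ⟨k, hkJ⟩ := NonlocalDiffusion.exists_continuous_kernel O τ hτ J hJ_lip
  refine NonlocalDiffusion.spectral_gap_and_decay hkJ (fun x => ?_) hJ_pos hspec
  refine Eq.trans (integral_congr_ae (.of_forall fun y => ?_))
    (((hμ x).integral_comp (τ x).toHomeomorph.measurableEmbedding _).trans hJ_mass)
  simp only [hkJ]
  conv_rhs => rw [← hτ x]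
  exact congrArg (fun s => (J s : ℝ)) ((nndist_comm x y).trans ((τ x).isometry.nndist_eq y x).symm)
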